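/- Let $K$ be a function field in one variable over a finite field $\mathbb{F}_q$ that is its exact field of constants (i.e. $\mathbb{F}_q$ is algebraically closed in $K$), and suppose $q \equiv -1 \bmod 3$. For a place $\mathfrak{p}$ of $K$ let $v_\mathfrak{p}$ be its valuation and let its degree be the degree of its residue field over $\mathbb{F}_q$. Let $L/K$ be a Galois extension of degree $3$; a place of $K$ is called ramified in $L$ if some place of $L$ above it has ramification index greater than $1$. Then: (1) there exist $y \in L$ and $a \in K$ such that $L = K(y)$ and the minimal polynomial of $y$ over $K$ is $X^3 - 3X - a$; (2) every place of $K$ that is ramified in $L$ has even degree; (3) more precisely, for all $y \in L$ and $a \in K$ such that $L = K(y)$ and $y$ has minimal polynomial $X^3 - 3X - a$ over $K$, every place $\mathfrak{p}$ of $K$ with $v_\mathfrak{p}(a) < 0$ has even degree, and every place $\mathfrak{p}$ of $K$ that is ramified in $L$ satisfies $v_\mathfrak{p}(a) < 0$. -/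

import Mathlib

open Polynomial IntermediateField

/-- A place of a function field `K` with constant field `k`, given by its valuation ring: a
valuation ring of `K` that contains `k` and is different from `K`. -/
structure Place (k K : Type*) [Field k] [Field K] [Algebra k K] where
  /-- The valuation ring of the place. -/
  ring : ValuationSubring K
  algebraMap_mem : ∀ c : k, algebraMap k K c ∈ ring
  ne_top : ring ≠ ⊤

namespace Place

section Degree

variable {k K : Type*} [Field k] [Field K] [Algebra k K]

/-- The valuation ring of a place is an algebra over the field of constants. -/
noncomputable instance (p : Place k K) : Algebra k p.ring :=
  ((algebraMap k K).codRestrict p.ring p.algebraMap_mem).toAlgebra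

/-- The residue field of a place. -/
abbrev ResidueField (p : Place k K) : Type _ := IsLocalRing.ResidueField p.ring

/-- The degree of a place: the degree of its residue field over the field of constants. -/
noncomputable def degree (p : Place k K) : ℕ := Module.finrank k p.ResidueField

/-- `a` has a pole at the place `p`, that is `v_p(a) < 0`. Mathlib writes valuations
multiplicatively with the order reversed, so `v_p(a) < 0` reads `1 < p.ring.valuation a`. -/
def ValNeg (p : Place k K) (a : K) : Prop := 1 < p.ring.valuation a

end Degree

section Ramification

variable {k K L : Type*} [Field k] [Field K] [Field L] [Algebra k K] [Algebra k L] [Algebra K L]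

/-- The place `P` of `L` lies above the place `p` of `K`. -/
def LiesOver (P : Place k L) (p : Place k K) : Prop :=
  P.ring.comap (algebraMap K L) = p.ring

theorem LiesOver.algebraMap_mem {P : Place k L} {p : Place k K} (h : P.LiesOver p)
    (x : p.ring) : algebraMap K L x ∈ P.ring := by
  have hx : (x : K) ∈ P.ring.comap (algebraMap K L) := by
    rw [show P.ring.comap (algebraMap K L) = p.ring from h]
    exact x.2
  exact hx

/-- The inclusion of the valuation ring of `p` in that of a place above `p`. -/
def LiesOver.ringHom {P : Place k L} {p : Place k K} (h : P.LiesOver p) : p.ring →+* P.ring :=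
  ((algebraMap K L).comp p.ring.subtype).codRestrict P.ring h.algebraMap_mem

/-- The ramification index `e(P|p)`: the largest `n` such that the maximal ideal of `p` is
contained in the `n`-th power of the maximal ideal of `P`. -/
noncomputable def LiesOver.ramificationIdx {P : Place k L} {p : Place k K}
    (h : P.LiesOver p) : ℕ :=
  letI : Algebra p.ring P.ring := h.ringHom.toAlgebra
  Ideal.ramificationIdx' (IsLocalRing.maximalIdeal p.ring) (IsLocalRing.maximalIdeal P.ring)

variable (L) in
/-- The place `p` of `K` ramifies in `L`: some place of `L` above it has ramification index
greater than one. -/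
def IsRamified (p : Place k K) : Prop :=
  ∃ (P : Place k L) (h : P.LiesOver p), 1 < h.ramificationIdx

end Ramification

end Place

/-- `y` is a primitive element of `L/K` with minimal polynomial `X ^ 3 - 3 X - a`. -/
def IsImpureGenerator {K L : Type*} [Field K] [Field L] [Algebra K L] (y : L) (a : K) : Prop :=
  K⟮y⟯ = ⊤ ∧ minpoly K y = X ^ 3 - 3 * X - C a

/-! Since q ≡ -1 mod 3, neither 𝔽_q nor K contains a primitive cube root of unity. This allows a
trace-zero element of L to be rescaled into a root y of X³ - 3X - a. As L/K is cyclic, the quadratic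
resolvent S² + aS + a² = 3 has a root s in K. At a pole of a, s/a reduces to a root of X² + X + 1.
The residue field, a finite extension of 𝔽_q, then has even degree (`ValNeg.even_degree`). If a is
integral at p, then f = X³ - 3X - a has a root y with f'(y) a unit at P. Euler's dual-basis formula
writes f'(y)r in powers of y with traces as coefficients, so the maximal ideal of P is generated by
that of p and e ≤ 1 (`exists_combination`, `ramificationIdx_le_one`). -/

section FiniteField

/-- A finite field whose order is `-1` modulo `3` has no primitive cube root of unity. -/
theorem FiniteField.sq_add_self_add_one_ne_zero {F : Type*} [Field F] [Finite F]
    (hF : (Nat.card F : ℤ) ≡ -1 [ZMOD 3]) (c : F) : c ^ 2 + c + 1 ≠ 0 := by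
  intro hc
  have := Fintype.ofFinite F
  have hq : ((Nat.card F : ℕ) : F) = 0 := by
    rw [Nat.card_eq_fintype_card]; exact FiniteField.cast_card_eq_zero F
  have hpow : c ^ Nat.card F = c := by
    rw [Nat.card_eq_fintype_card]; exact FiniteField.pow_card c
  obtain ⟨m, hm⟩ : ∃ m, Nat.card F = 3 * m + 2 := ⟨Nat.card F / 3, by
    have : (Nat.card F : ℤ) % 3 = -1 % 3 := hF
    omega⟩
  have hc3 : c ^ 3 = 1 := by linear_combination (c - 1) * hc
  have hc2 : c ^ 2 = c := by
    rw [hm, pow_add, pow_mul, hc3, one_pow, one_mul] at hpow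
    exact hpow
  have hc0 : c ≠ 0 := by rintro rfl; simp at hc
  have hc1 : c = 1 := mul_left_cancel₀ hc0 (by linear_combination hc2)
  subst hc1
  rw [hm] at hq
  push_cast at hq
  -- Both 3 and 3m + 2 vanish in F, while 3(m + 1) - (3m + 2) = 1.
  exact one_ne_zero (α := F) (by linear_combination (m + 1 : F) * hc - hq)

theorem FiniteField.three_ne_zero_of_card {F : Type*} [Field F] [Finite F]
    (hF : (Nat.card F : ℤ) ≡ -1 [ZMOD 3]) : (3 : F) ≠ 0 := fun h ↦
  sq_add_self_add_one_ne_zero hF 1 (by linear_combination h)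

/-- If the extension field `F` of a field of order `-1` modulo `3` is finite and has a primitive
cube root of unity, its degree is even. -/
theorem FiniteField.even_finrank_of_sq_add_self_add_one_eq_zero {k F : Type*} [Field k] [Finite k]
    [Field F] [Algebra k F] [FiniteDimensional k F] (hk : (Nat.card k : ℤ) ≡ -1 [ZMOD 3]) {c : F}
    (hc : c ^ 2 + c + 1 = 0) : Even (Module.finrank k F) := by
  by_contra hodd
  rw [Nat.not_even_iff_odd] at hodd
  have : Finite F := Module.finite_of_finite k
  refine sq_add_self_add_one_ne_zero ?_ c hc
  rw [Module.natCard_eq_pow_finrank (K := k), Nat.cast_pow]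
  simpa [hodd.neg_one_pow] using hk.pow (Module.finrank k F)

/-- A field with exact field of constants of order `-1` modulo `3` has no primitive cube root of
unity. -/
theorem sq_add_self_add_one_ne_zero_of_algebraicClosure_eq_bot {k K : Type*} [Field k] [Finite k]
    [Field K] [Algebra k K] (hconst : algebraicClosure k K = ⊥)
    (hk : (Nat.card k : ℤ) ≡ -1 [ZMOD 3]) (c : K) : c ^ 2 + c + 1 ≠ 0 := by
  intro hc
  have hint : IsIntegral k c := by
    refine ⟨X ^ 2 + X + 1, ?_, by simpa using hc⟩
    rw [show (X ^ 2 + X + 1 : k[X]) = X ^ 2 + X + C 1 by simp]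
    monicity!
  have hmem : c ∈ algebraicClosure k K := mem_algebraicClosure_iff'.2 hint
  rw [hconst, IntermediateField.mem_bot] at hmem
  obtain ⟨d, rfl⟩ := hmem
  refine FiniteField.sq_add_self_add_one_ne_zero hk d ((algebraMap k K).injective ?_)
  simpa using hc

end FiniteField

/-! ### Cyclic cubic extensions: the generator and its resolvent -/

section CyclicCubic

variable {K L : Type*} [Field K] [Field L] [Algebra K L]

/-- The automorphism `σ` generates a Galois group of order three. -/
structure IsCubicGenerator (σ : L ≃ₐ[K] L) : Prop where
  exists_ne : ∃ x, σ x ≠ x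
  apply_apply_apply (x : L) : σ (σ (σ x)) = x
  mem_range {x : L} : σ x = x → x ∈ Set.range (algebraMap K L)

theorem exists_isCubicGenerator [IsGalois K L] (h : Module.finrank K L = 3) :
    ∃ σ : L ≃ₐ[K] L, IsCubicGenerator σ := by
  have : FiniteDimensional K L := Module.finite_of_finrank_pos (by omega)
  have hcard : Nat.card (L ≃ₐ[K] L) = 3 := by rw [IsGalois.card_aut_eq_finrank, h]
  have : Fact (Nat.Prime 3) := ⟨Nat.prime_three⟩
  have := isCyclic_of_prime_card hcard
  obtain ⟨σ, hσ⟩ := IsCyclic.exists_generator (α := L ≃ₐ[K] L)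
  refine ⟨σ, ?_, fun x ↦ ?_, fun {x} hx ↦ ?_⟩
  · by_contra! hfix
    have h1 : σ = 1 := AlgEquiv.ext hfix
    have := orderOf_eq_card_of_forall_mem_zpowers hσ
    rw [hcard, h1, orderOf_one] at this
    omega
  · have := pow_card_eq_one' (x := σ)
    rw [hcard] at this
    exact DFunLike.congr_fun this x
  · rw [IsGalois.mem_range_algebraMap_iff_fixed]
    intro τ
    have hle : Subgroup.zpowers σ ≤ MulAction.stabilizer (L ≃ₐ[K] L) x := by
      rw [Subgroup.zpowers_le]; exact hx
    exact hle (hσ τ)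

theorem IsCubicGenerator.trace_mem {σ : L ≃ₐ[K] L} (hσ : IsCubicGenerator σ) (x : L) :
    ∃ c : K, algebraMap K L c = x + σ x + σ (σ x) :=
  hσ.mem_range (by rw [map_add, map_add, hσ.apply_apply_apply]; ring)

theorem isImpureGenerator_of_finrank_eq_three (h : Module.finrank K L = 3) {y : L} {a : K}
    (hy : y ∉ Set.range (algebraMap K L)) (heq : y ^ 3 - 3 * y = algebraMap K L a) :
    IsImpureGenerator y a := by
  have : FiniteDimensional K L := Module.finite_of_finrank_pos (by omega)
  have := IntermediateField.isSimpleOrder_of_finrank_prime K L (h ▸ Nat.prime_three)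
  have htop : K⟮y⟯ = ⊤ := (eq_bot_or_eq_top _).resolve_left fun hbot ↦
    hy (IntermediateField.mem_bot.1 (IntermediateField.adjoin_simple_eq_bot_iff.1 hbot))
  have hint : IsIntegral K y := Algebra.IsIntegral.isIntegral y
  refine ⟨htop, ?_⟩
  have hmonic : (X ^ 3 - 3 * X - C a : K[X]).Monic := by
    rw [show (X ^ 3 - 3 * X - C a : K[X]) = X ^ 3 - C 3 * X - C a from rfl]
    monicity!
  have hdeg : (X ^ 3 - 3 * X - C a : K[X]).natDegree = 3 := by
    rw [show (X ^ 3 - 3 * X - C a : K[X]) = X ^ 3 - C 3 * X - C a from rfl]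
    compute_degree!
  refine (Polynomial.eq_of_monic_of_dvd_of_natDegree_le (minpoly.monic hint) hmonic
    (minpoly.dvd K y ?_) ?_).symm
  · simp [heq, map_ofNat]
  · rw [hdeg, ← IntermediateField.adjoin.finrank hint, htop, IntermediateField.finrank_top', h]

theorem IsCubicGenerator.exists_isImpureGenerator {σ : L ≃ₐ[K] L} (hσ : IsCubicGenerator σ)
    (h : Module.finrank K L = 3) (h3 : (3 : L) ≠ 0) (hK : ∀ c : K, c ^ 2 + c + 1 ≠ 0) :
    ∃ (y : L) (a : K), IsImpureGenerator y a := by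
  obtain ⟨v, hv⟩ := hσ.exists_ne
  obtain ⟨w, htr, hw⟩ : ∃ w : L, w + σ w + σ (σ w) = 0 ∧ w ≠ 0 :=
    ⟨v - σ v, by simp only [map_sub, hσ.apply_apply_apply]; ring, sub_ne_zero.2 hv.symm⟩
  have hσw : σ w ≠ w := by
    intro hfix
    rw [hfix, hfix] at htr
    exact mul_ne_zero h3 hw (by linear_combination htr)
  have hσσw : σ (σ w) = -w - σ w := by linear_combination htr
  have hw' : σ w ≠ 0 := by simpa using hw
  have hw'' : σ (σ w) ≠ 0 := by simpa using hw
  obtain ⟨Q, hQ⟩ : ∃ Q : K, algebraMap K L Q = w ^ 2 + w * σ w + σ w ^ 2 :=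
    hσ.mem_range (by simp only [map_add, map_mul, map_pow, hσσw]; ring)
  -- If Q = 0, then σw/w is a primitive cube root of unity fixed by σ, hence in K.
  have hQ0 : algebraMap K L Q ≠ 0 := by
    intro h0
    rw [hQ] at h0
    obtain ⟨r, hr⟩ : ∃ r : K, algebraMap K L r = σ w / w := by
      refine hσ.mem_range ?_
      rw [map_div₀, div_eq_div_iff hw' hw, hσσw]
      linear_combination -h0
    refine hK r ((algebraMap K L).injective ?_)
    simp only [map_add, map_pow, map_one, map_zero, hr]
    field_simp
    linear_combination h0
  obtain ⟨n, hn⟩ : ∃ n : K, algebraMap K L n = w ^ 3 - algebraMap K L Q * w :=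
    hσ.mem_range (by
      simp only [map_sub, map_mul, map_pow, AlgEquiv.commutes]
      rw [hQ]; ring)
  -- Squaring w(w² - Q) = n and setting u = 3w²/Q gives u(u - 3)² = 27n²/Q³. The shift y = u - 2
  -- turns the left side into y³ - 3y + 2.
  refine ⟨3 * w ^ 2 / algebraMap K L Q - 2, 27 * n ^ 2 / Q ^ 3 - 2,
    isImpureGenerator_of_finrank_eq_three h ?_ ?_⟩
  · rintro ⟨c, hc⟩
    have hfix := congrArg σ hc
    rw [AlgEquiv.commutes, hc] at hfix
    simp only [AlgEquiv.commutes, map_sub, map_div₀, map_mul, map_pow, map_ofNat] at hfix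
    have h2 : (w - σ w) * σ (σ w) = 0 := by
      rw [sub_left_inj, div_left_inj' hQ0] at hfix
      have := mul_left_cancel₀ h3 hfix
      rw [hσσw]
      linear_combination -this
    exact mul_ne_zero (sub_ne_zero.2 hσw.symm) hw'' h2
  · simp only [map_sub, map_div₀, map_mul, map_pow, map_ofNat, hn]
    field_simp
    ring

/-- The relations between the conjugates of an element with minimal polynomial `X³ - 3X - a`. -/
structure IsImpureRoot (σ : L ≃ₐ[K] L) (y : L) (a : K) : Prop where
  eq : y ^ 3 - 3 * y = algebraMap K L a
  quadric : y ^ 2 + y * σ y + σ y ^ 2 = 3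
  trace : y + σ y + σ (σ y) = 0

theorem IsImpureRoot.apply {σ : L ≃ₐ[K] L} {y : L} {a : K} (h : IsImpureRoot σ y a) :
    IsImpureRoot σ (σ y) a where
  eq := by simpa [map_ofNat] using congrArg σ h.eq
  quadric := by simpa [map_ofNat] using congrArg σ h.quadric
  trace := by simpa using congrArg σ h.trace

theorem IsImpureGenerator.isImpureRoot {σ : L ≃ₐ[K] L} (hσ : IsCubicGenerator σ) {y : L} {a : K}
    (h : IsImpureGenerator y a) : IsImpureRoot σ y a := by
  have heq : y ^ 3 - 3 * y = algebraMap K L a := by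
    have := minpoly.aeval K y
    rw [h.2] at this
    simpa [sub_eq_zero, map_ofNat] using this
  have hne : σ y ≠ y := by
    intro hfix
    obtain ⟨c, rfl⟩ := hσ.mem_range hfix
    obtain ⟨x, hx⟩ := hσ.exists_ne
    have hx' : x ∈ K⟮algebraMap K L c⟯ := h.1 ▸ IntermediateField.mem_top
    rw [IntermediateField.adjoin_simple_eq_bot_iff.2 (_root_.algebraMap_mem _ c),
      IntermediateField.mem_bot] at hx'
    obtain ⟨d, rfl⟩ := hx'
    exact hx (σ.commutes d)
  have hq : y ^ 2 + y * σ y + σ y ^ 2 = 3 := by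
    refine mul_left_cancel₀ (sub_ne_zero.2 hne) ?_
    have := congrArg σ heq
    simp only [map_sub, map_mul, map_pow, map_ofNat, AlgEquiv.commutes] at this
    linear_combination this - heq
  refine ⟨heq, hq, mul_left_cancel₀ (a := σ (σ y) - y) (sub_ne_zero.2 fun hfix ↦ hne ?_) ?_⟩
  · rw [← hfix, hσ.apply_apply_apply, hfix]
  · have := congrArg σ hq
    simp only [map_add, map_mul, map_pow, map_ofNat] at this
    linear_combination this - hq

/-- The quadratic resolvent of `X³ - 3X - a` splits. -/
theorem IsImpureRoot.exists_resolvent_root {σ : L ≃ₐ[K] L} (hσ : IsCubicGenerator σ)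
    (h3 : (3 : L) ≠ 0) {y : L} {a : K} (h : IsImpureRoot σ y a) :
    ∃ s : K, s ^ 2 + a * s + a ^ 2 = 3 := by
  obtain ⟨r, hr⟩ : ∃ r : K, algebraMap K L r =
      y ^ 2 * σ y + σ y ^ 2 * σ (σ y) + σ (σ y) ^ 2 * y :=
    hσ.mem_range (by
      simp only [map_add, map_mul, map_pow, hσ.apply_apply_apply]; ring)
  -- The cyclic sum r and its image under an odd permutation of the roots add up to -3a; hence the
  -- factor 3.
  refine ⟨r / 3, (algebraMap K L).injective ?_⟩
  have hz : σ (σ y) = -y - σ y := by linear_combination h.trace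
  rw [hz] at hr
  have hq := h.quadric
  generalize σ y = z at *
  simp only [map_add, map_mul, map_pow, map_div₀, map_ofNat, hr, ← h.eq]
  have hr' : y ^ 2 * z + z ^ 2 * (-y - z) + (-y - z) ^ 2 * y = 3 * (y ^ 2 * z + y - z) := by
    linear_combination (y - z) * hq
  rw [hr', mul_div_cancel_left₀ _ h3]
  linear_combination (y ^ 2 - 1) ^ 2 * hq

end CyclicCubic

/-! ### Valuations and their conjugates -/

section Valuation

variable {K L Γ₀ : Type*} [Field K] [Field L] [Algebra K L] [LinearOrderedCommGroupWithZero Γ₀]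

theorem Polynomial.coeff_divX_iterate {R : Type*} [Semiring R] (p : R[X]) (j n : ℕ) :
    (divX^[j] p).coeff n = p.coeff (n + j) := by
  induction j generalizing n with
  | zero => simp
  | succ j ih => rw [Function.iterate_succ_apply', coeff_divX, ih]; congr 1; ring

theorem Polynomial.aeval_divX_iterate (p : K[X]) (x : L) (j : ℕ) :
    aeval x (divX^[j] p) = aeval x (divX^[j + 1] p) * x + algebraMap K L (p.coeff j) := by
  conv_lhs => rw [← divX_mul_X_add (divX^[j] p)]
  simp [Function.iterate_succ_apply', coeff_divX_iterate]

/-- An integral element for a valuation is a fraction whose numerator and denominator are integral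
for all conjugate valuations, with a denominator of value one. -/
theorem Valuation.exists_common_denominator (v : Valuation L Γ₀) {x : L} (hx : IsAlgebraic K x)
    (hvx : v x ≤ 1) :
    ∃ s, v s = 1 ∧ ∀ τ : L ≃ₐ[K] L, v (τ s) ≤ 1 ∧ v (τ (s * x)) ≤ 1 := by
  obtain ⟨p, hp, hpx⟩ := hx
  obtain ⟨i₀, hi₀, hmax⟩ := p.support.exists_max_image (fun i ↦ v (algebraMap K L (p.coeff i)))
    (support_nonempty.2 hp)
  have hc : p.coeff i₀ ≠ 0 := mem_support_iff.1 hi₀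
  have hvc : 0 < v (algebraMap K L (p.coeff i₀)) := by
    rw [zero_lt_iff]; simpa using hc
  obtain ⟨q, hqx, hq, hq1⟩ : ∃ q : K[X], aeval x q = 0 ∧
      (∀ i, v (algebraMap K L (q.coeff i)) ≤ 1) ∧ v (algebraMap K L (q.coeff i₀)) = 1 := by
    refine ⟨C (p.coeff i₀)⁻¹ * p, by simp [hpx], fun i ↦ ?_, by simp [hc]⟩
    rw [coeff_C_mul, map_mul, map_mul, map_inv₀, map_inv₀]
    by_cases hi : i ∈ p.support
    · exact (inv_mul_le_one₀ hvc).2 (hmax i hi)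
    · simp [notMem_support_iff.1 hi]
  -- The candidates for s are the Horner tails t_j of q at x, with t_0 = 0 and t_j = t_{j+1} x +
  -- q_j. If τx is not integral, induction on j bounds τ(t_j x), hence τ(t_j).
  have key (τ : L ≃ₐ[K] L) (j : ℕ) : v (τ (aeval x (divX^[j] q))) ≤ 1 ∧
      v (τ (aeval x (divX^[j] q) * x)) ≤ 1 := by
    have hrec (j : ℕ) := congrArg τ (aeval_divX_iterate q x j)
    simp only [map_add, map_mul, AlgEquiv.commutes] at hrec ⊢
    rcases le_or_gt (v (τ x)) 1 with hτx | hτx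
    · have h1 (r : K[X]) (hr : ∀ i, v (algebraMap K L (r.coeff i)) ≤ 1) :
          v (τ (aeval x r)) ≤ 1 := by
        rw [aeval_eq_sum_range, map_sum]
        refine v.map_sum_le fun i _ ↦ ?_
        rw [map_smul, Algebra.smul_def, map_mul, map_pow, map_pow]
        exact mul_le_one' (hr i) (pow_le_one' hτx i)
      have h2 := h1 (divX^[j] q) fun i ↦ by rw [coeff_divX_iterate]; exact hq _
      exact ⟨h2, mul_le_one' h2 hτx⟩
    · suffices h : v (τ (aeval x (divX^[j] q)) * τ x) ≤ 1 by
        rw [map_mul] at h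
        refine ⟨?_, h⟩
        by_contra! hlt
        exact absurd h (not_le.2 (one_lt_mul'' hlt hτx))
      induction j with
      | zero => simp [hqx]
      | succ j ih =>
        have hle : v (τ (aeval x (divX^[j] q))) ≤ 1 := by
          rw [map_mul] at ih
          by_contra! hlt
          exact absurd ih (not_le.2 (one_lt_mul'' hlt hτx))
        rw [eq_sub_of_add_eq (hrec j).symm]
        exact v.map_sub_le hle (hq j)
  -- Otherwise q_{i₀} = t_{i₀} - t_{i₀+1} x would have value less than 1.
  obtain ⟨j, hj⟩ : ∃ j, v (aeval x (divX^[j] q)) = 1 := by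
    by_contra! hne
    have hlt (j : ℕ) : v (aeval x (divX^[j] q)) < 1 :=
      lt_of_le_of_ne (key AlgEquiv.refl j).1 (hne j)
    refine hq1.not_lt ?_
    rw [eq_sub_of_add_eq' (aeval_divX_iterate q x i₀).symm]
    refine v.map_sub_lt (hlt _) ?_
    rw [map_mul]
    exact mul_lt_one_of_lt_of_le (hlt _) hvx
  exact ⟨_, hj, fun τ ↦ key τ j⟩

/-- There is an element of value one and integral for all conjugate valuations, that has positive
value at a given conjugate valuation, unless the latter has the same maximal ideal. -/
theorem Valuation.exists_separating [Algebra.IsAlgebraic K L] (v : Valuation L Γ₀)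
    {σ : L ≃ₐ[K] L} (hσ : ∀ x, σ (σ (σ x)) = x) :
    ∃ w, v w = 1 ∧ (∀ τ : L ≃ₐ[K] L, v (τ w) ≤ 1) ∧
      ∀ z, v z < 1 → v (σ z) ≤ 1 → v (σ (w * z)) < 1 := by
  by_cases h : ∀ x, v x ≤ 1 → v (σ x) ≤ 1
  · refine ⟨1, by simp, by simp, fun z hz hσz ↦ lt_of_le_of_ne (by simpa using hσz) fun h1 ↦ ?_⟩
    rw [one_mul] at h1
    -- Two further applications of σ bring σ(z⁻¹) back to z⁻¹, which is not integral.
    have h2 := h _ (h _ (show v (σ z⁻¹) ≤ 1 by simp [h1]))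
    rw [hσ, map_inv₀] at h2
    have hz0 : z ≠ 0 := by rintro rfl; simp at h1
    have hvz : 0 < v z := by rw [zero_lt_iff]; simpa using hz0
    exact absurd h2 (not_le.2 ((one_lt_inv₀ hvz).2 hz))
  · push Not at h
    obtain ⟨x, hx, hσx⟩ := h
    obtain ⟨s, hs, hsτ⟩ := v.exists_common_denominator (Algebra.IsAlgebraic.isAlgebraic (R := K) x) hx
    refine ⟨s, hs, fun τ ↦ (hsτ τ).1, fun z _ hσz ↦ ?_⟩
    have h1 := (hsτ σ).2
    rw [map_mul, map_mul] at h1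
    rw [map_mul, map_mul]
    refine mul_lt_one_of_lt_of_le ?_ hσz
    by_contra! hle
    exact absurd h1 (not_le.2 (hσx.trans_le (le_mul_of_one_le_left' hle)))

/-- Traces of integral multiples of s * x become small. The factor s combines a common denominator
with one separating element for each of σ and σ². -/
theorem IsCubicGenerator.exists_multiple [FiniteDimensional K L] {σ : L ≃ₐ[K] L}
    (hσ : IsCubicGenerator σ) (v : Valuation L Γ₀) {x : L} (hx : v x < 1) :
    ∃ s, v s = 1 ∧ v (s * x) < 1 ∧ v (σ (s * x)) < 1 ∧ v (σ (σ (s * x))) < 1 := by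
  obtain ⟨s, hs, hsτ⟩ := v.exists_common_denominator
    (Algebra.IsAlgebraic.isAlgebraic (R := K) x) hx.le
  obtain ⟨w₁, hw₁, hw₁τ, h₁⟩ := v.exists_separating hσ.apply_apply_apply
  obtain ⟨w₂, hw₂, hw₂τ, h₂⟩ := v.exists_separating (σ := σ.trans σ)
    (fun x ↦ by simp [hσ.apply_apply_apply])
  have hsx : v (s * x) < 1 := by simpa [hs] using hx
  refine ⟨w₁ * w₂ * s, by simp [hw₁, hw₂, hs], by simpa [hw₁, hw₂, hs] using hx, ?_, ?_⟩
  · have := mul_lt_one_of_lt_of_le (h₁ _ hsx (hsτ σ).2) (hw₂τ σ)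
    rwa [← map_mul, ← map_mul, show w₁ * (s * x) * w₂ = w₁ * w₂ * s * x by ring] at this
  · have := mul_lt_one_of_lt_of_le (h₂ _ hsx (hsτ (σ.trans σ)).2) (hw₁τ (σ.trans σ))
    rwa [← map_mul, ← map_mul, show w₂ * (s * x) * w₁ = w₁ * w₂ * s * x by ring] at this

theorem IsImpureRoot.valuation_le_one {σ : L ≃ₐ[K] L} {y : L} {a : K} (h : IsImpureRoot σ y a)
    (v : Valuation L Γ₀) (h3 : v 3 = 1) (ha : v (algebraMap K L a) ≤ 1) : v y ≤ 1 := by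
  by_contra! hy
  have hy2 : 1 < v (y ^ 2) := by rw [map_pow]; exact one_lt_pow₀ hy two_ne_zero
  have h1 : v (y ^ 2 - 3) = v (y ^ 2) := v.map_sub_eq_of_lt_left (by rwa [h3])
  rw [← h.eq, show y ^ 3 - 3 * y = y * (y ^ 2 - 3) by ring, map_mul, h1] at ha
  exact absurd ha (not_le.2 (one_lt_mul'' hy hy2))

/-- The polynomial `X³ - 3X - a` has a root that is simple modulo the maximal ideal. -/
theorem IsImpureRoot.exists_simple {σ : L ≃ₐ[K] L} {y : L} {a : K} (h : IsImpureRoot σ y a)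
    (v : Valuation L Γ₀) (h3 : v 3 = 1) (ha : v (algebraMap K L a) ≤ 1) :
    ∃ y, IsImpureRoot σ y a ∧ v (y ^ 2 - 1) = 1 := by
  by_contra! hne
  have hlt (z : L) (hz : IsImpureRoot σ z a) : v (z ^ 2 - 1) < 1 := by
    refine lt_of_le_of_ne (v.map_sub_le ?_ (by simp)) (hne z hz)
    rw [map_pow]
    exact pow_le_one' (hz.valuation_le_one v h3 ha) 2
  have hy := hlt y h
  have hz := hlt _ h.apply
  have hzz := hlt _ h.apply.apply
  have e : σ (σ y) = -y - σ y := by linear_combination h.trace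
  have hq := h.quadric
  -- The squares of the three roots sum to 6, so this sum is 6 - 3 = 3, a unit.
  have hs : v ((y ^ 2 - 1) + (σ y ^ 2 - 1) + (σ (σ y) ^ 2 - 1)) = 1 := by
    rw [← h3]; congr 1; rw [e]; linear_combination 2 * hq
  exact hs.not_lt (v.map_add_lt (v.map_add_lt hy hz) hzz)

/-- An element of the maximal ideal is, up to a unit, a combination of elements of `K` that belong
to the maximal ideal. -/
theorem IsImpureRoot.exists_combination [FiniteDimensional K L] {σ : L ≃ₐ[K] L}
    (hσ : IsCubicGenerator σ) {y : L} {a : K} (h : IsImpureRoot σ y a)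
    (v : Valuation L Γ₀) (h3 : v 3 = 1) (ha : v (algebraMap K L a) ≤ 1) {x : L} (hx : v x < 1) :
    ∃ (u b : L) (c : Fin 3 → K), v u = 1 ∧ v b ≤ 1 ∧ (∀ i, v (algebraMap K L (c i)) < 1) ∧
      u * x = ∑ i, algebraMap K L (c i) * b ^ (i : ℕ) := by
  obtain ⟨y, h, hy1⟩ := h.exists_simple v h3 ha
  have hy := h.valuation_le_one v h3 ha
  have hy' := h.apply.valuation_le_one v h3 ha
  have hy'' := h.apply.apply.valuation_le_one v h3 ha
  obtain ⟨s, hs, hr, hr', hr''⟩ := hσ.exists_multiple v hx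
  set r := s * x
  -- The factors y² - 3, y, 1 are the coefficients of f(X)/(X - y). Divided by f'(y) = 3(y² - 1),
  -- they form the trace-dual basis of 1, y, y².
  obtain ⟨c₀, hc₀⟩ := hσ.trace_mem (r * (y ^ 2 - 3))
  obtain ⟨c₁, hc₁⟩ := hσ.trace_mem (r * y)
  obtain ⟨c₂, hc₂⟩ := hσ.trace_mem r
  have hsq {z : L} (hz : v z ≤ 1) : v (z ^ 2 - 3) ≤ 1 :=
    v.map_sub_le (by rw [map_pow]; exact pow_le_one' hz 2) h3.le
  have htr {z : L} (hz : v z ≤ 1) (hz' : v (σ z) ≤ 1) (hz'' : v (σ (σ z)) ≤ 1) :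
      v (r * z + σ (r * z) + σ (σ (r * z))) < 1 := by
    simp only [map_mul σ]
    refine v.map_add_lt (v.map_add_lt ?_ ?_) ?_
    all_goals
      rw [map_mul]
      exact mul_lt_one_of_lt_of_le ‹_› ‹_›
  refine ⟨3 * (y ^ 2 - 1) * s, y, ![c₀, c₁, c₂], by simp [h3, hs, hy1], hy, fun i ↦ ?_, ?_⟩
  · fin_cases i
    · simp only [Fin.zero_eta, Matrix.cons_val_zero, hc₀]
      refine htr (hsq hy) ?_ ?_
      · simpa only [map_sub, map_pow, map_ofNat] using hsq hy'
      · simpa only [map_sub, map_pow, map_ofNat] using hsq hy''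
    · simp only [Fin.mk_one, Matrix.cons_val_one, Matrix.cons_val_zero, hc₁]
      exact htr hy hy' hy''
    · simp only [Fin.reduceFinMk, Matrix.cons_val, hc₂]
      exact v.map_add_lt (v.map_add_lt hr hr') hr''
  · have e : σ (σ y) = -y - σ y := by linear_combination h.trace
    have hq := h.quadric
    simp only [Fin.sum_univ_three, Matrix.cons_val, hc₀, hc₁, hc₂, Fin.isValue, Fin.val_zero,
      Fin.val_one, Fin.val_two]
    rw [mul_assoc]
    change 3 * (y ^ 2 - 1) * r = _
    simp only [map_mul, map_sub, map_pow, map_ofNat, e]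
    linear_combination -(σ r + σ (σ r)) * hq

end Valuation

/-! ### Ramification index bound, residue degrees and poles -/

theorem Ideal.ramificationIdx'_le_one {R S : Type*} [CommRing R] [CommRing S] [Algebra R S]
    {p : Ideal R} {P : Ideal S} (h : P ≤ p.map (algebraMap R S)) :
    Ideal.ramificationIdx' p P ≤ 1 := by
  by_contra! hlt
  have h2 : p.map (algebraMap R S) ≤ P ^ 2 := le_pow_of_le_ramificationIdx' hlt
  have hle (n : ℕ) : P ≤ P ^ n := by
    induction n with
    | zero => simp
    | succ n ih =>
      calc P ≤ P ^ 2 := h.trans h2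
        _ = P * P := sq P
        _ ≤ P ^ n * P := Ideal.mul_mono_left ih
        _ = P ^ (n + 1) := (pow_succ _ _).symm
  -- P = P² makes all powers of P equal, and the index of an unbounded set of exponents is 0 by
  -- convention.
  have h0 : Ideal.ramificationIdx' p P = 0 := ramificationIdx'_eq_zero fun n ↦
    ⟨n + 1, h2.trans ((Ideal.pow_le_self two_ne_zero).trans (hle _)), n.lt_succ_self⟩
  omega

namespace Place

section Degree

variable {k K : Type*} [Field k] [Field K] [Algebra k K]

instance (p : Place k K) : IsScalarTower k p.ring K :=
  .of_algebraMap_eq fun _ ↦ rfl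

theorem valuation_algebraMap (p : Place k K) {c : k} (hc : c ≠ 0) :
    p.ring.valuation (algebraMap k K c) = 1 := by
  refine le_antisymm ((p.ring.valuation_le_one_iff _).2 (p.algebraMap_mem c)) ?_
  have h := (p.ring.valuation_le_one_iff _).2 (p.algebraMap_mem c⁻¹)
  rw [map_inv₀, map_inv₀] at h
  exact (inv_le_one₀ (by rw [zero_lt_iff]; simpa using hc)).1 h

theorem transcendental_of_inv_notMem (p : Place k K) {t : K} (ht : t⁻¹ ∉ p.ring) :
    Transcendental k t := fun halg ↦ by
  have hint : IsIntegral p.ring t⁻¹ := (isAlgebraic_iff_isIntegral.1 halg.inv).tower_top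
  obtain ⟨y, hy⟩ := IsIntegrallyClosed.isIntegral_iff.1 hint
  exact ht (hy ▸ y.2)

/-- Lifts of a linearly independent family of the residue field satisfy no polynomial relation in
an element of the maximal ideal. -/
theorem coeff_eq_zero_of_sum_eq_zero (p : Place k K) {ι : Type*} [Fintype ι] {b : ι → p.ring}
    (hb : LinearIndependent k fun i ↦ IsLocalRing.residue p.ring (b i)) {t : p.ring} (ht0 : t ≠ 0)
    (ht : t ∈ IsLocalRing.maximalIdeal p.ring) (n : ℕ) (g : ι → k[X])
    (hg : ∑ i, aeval t (g i) * b i = 0) (i : ι) : (g i).coeff n = 0 := by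
  have hdiv (g : k[X]) : aeval t g =
      aeval t (divX g) * t + algebraMap k p.ring (g.coeff 0) := by
    conv_lhs => rw [← divX_mul_X_add g]
    simp
  have h0 (g : ι → k[X]) (hg : ∑ i, aeval t (g i) * b i = 0) (i : ι) : (g i).coeff 0 = 0 := by
    refine Fintype.linearIndependent_iff.1 hb (fun i ↦ (g i).coeff 0) ?_ i
    have := congrArg (IsLocalRing.residue p.ring) hg
    rw [map_sum, map_zero] at this
    rw [← this]
    refine Finset.sum_congr rfl fun i _ ↦ ?_
    rw [hdiv, map_mul, map_add, map_mul, (IsLocalRing.residue_eq_zero_iff t).2 ht, mul_zero,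
      zero_add, Algebra.smul_def]
    rfl
  induction n generalizing g i with
  | zero => exact h0 g hg i
  | succ n ih =>
    rw [← coeff_divX]
    -- The constant terms vanish by reduction modulo the maximal ideal, so the relation can be
    -- divided by t.
    have hsum : ∑ i, aeval t (divX (g i)) * b i = 0 := by
      refine mul_left_cancel₀ ht0 ?_
      rw [mul_zero, ← hg, Finset.mul_sum]
      refine Finset.sum_congr rfl fun i _ ↦ ?_
      rw [hdiv (g i), h0 g hg i, map_zero]
      ring
    exact ih _ hsum i

open scoped IntermediateField.algebraAdjoinAdjoin in
/-- The residue fields of the places of a function field are finite over the field of constants. -/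
theorem finiteDimensional_residueField [Algebra (RatFunc k) K] [IsScalarTower k (RatFunc k) K]
    [FunctionField k K] (p : Place k K) : FiniteDimensional k p.ResidueField := by
  obtain ⟨x, hx⟩ : ∃ x, x ∉ p.ring := by
    by_contra! h
    exact p.ne_top (top_unique fun x _ ↦ h x)
  have hx0 : x ≠ 0 := by rintro rfl; exact hx p.ring.zero_mem
  set t : p.ring := ⟨x⁻¹, (p.ring.mem_or_inv_mem x).resolve_left hx⟩
  have ht0 : t ≠ 0 := fun h ↦ inv_ne_zero hx0 (congrArg Subtype.val h)
  have htm : t ∈ IsLocalRing.maximalIdeal p.ring := by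
    rw [← ValuationSubring.coe_mem_nonunits_iff, ValuationSubring.inv_mem_nonunits_iff]
    exact .inr hx
  have htr : Transcendental k (x⁻¹) := p.transcendental_of_inv_notMem (by rwa [inv_inv])
  have := FunctionField.finiteDimensional_of_adjoin_transcendental htr
  -- Lifts of k-independent residues are independent over k(x⁻¹), which bounds the residue degree by
  -- [K : k(x⁻¹)].
  refine Module.rank_lt_aleph0_iff.1 (lt_of_le_of_lt
    (rank_le (n := Module.finrank k⟮x⁻¹⟯ K) fun s hs ↦ ?_) (Cardinal.natCast_lt_aleph0))
  choose b hb using fun i : s ↦ IsLocalRing.residue_surjective (R := p.ring) (i : p.ResidueField)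
  have hlin : LinearIndependent k⟮x⁻¹⟯ fun i ↦ (b i : K) := by
    rw [← LinearIndependent.iff_fractionRing (R := Algebra.adjoin k {x⁻¹}),
      Fintype.linearIndependent_iff]
    intro r hr i
    have hmem (i : s) : ∃ g : k[X], aeval x⁻¹ g = (r i : K) :=
      (Algebra.adjoin_singleton_eq_range_aeval k x⁻¹).le (r i).2
    choose g hg using hmem
    have hg0 : g i = 0 := by
      ext n
      refine p.coeff_eq_zero_of_sum_eq_zero (b := b) (by simpa only [hb] using hs) ht0 htm n g ?_ i
      refine Subtype.val_injective ?_
      rw [ZeroMemClass.coe_zero, ← hr, AddSubmonoidClass.coe_finsetSum]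
      refine Finset.sum_congr rfl fun i _ ↦ ?_
      rw [MulMemClass.coe_mul, Algebra.smul_def]
      congr 1
      exact (aeval_algebraMap_apply K t (g i)).symm.trans (hg i)
    refine Subtype.val_injective ?_
    rw [← hg, hg0]
    simp
  simpa using hlin.fintype_card_le_finrank

theorem ValNeg.even_degree [Finite k] [Algebra (RatFunc k) K] [IsScalarTower k (RatFunc k) K]
    [FunctionField k K] (hk : (Nat.card k : ℤ) ≡ -1 [ZMOD 3]) {p : Place k K} {a s : K}
    (hs : s ^ 2 + a * s + a ^ 2 = 3) (ha : p.ValNeg a) : Even p.degree := by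
  have := p.finiteDimensional_residueField
  set v := p.ring.valuation
  have hva : 1 < v a := ha
  have ha0 : a ≠ 0 := by rintro rfl; simp at hva
  have hv3 : v 3 = 1 := by
    simpa [map_ofNat] using p.valuation_algebraMap (FiniteField.three_ne_zero_of_card hk)
  have hr : (s / a) ^ 2 + s / a + 1 = 3 / a ^ 2 := by
    field_simp
    linear_combination hs
  have hlt : v (3 / a ^ 2) < 1 := by
    rw [map_div₀, hv3, map_pow, one_div]
    exact inv_lt_one_of_one_lt₀ (one_lt_pow₀ hva two_ne_zero)
  -- If r = s/a had a pole, so would r(r + 1) = 3/a² - 1, which is integral.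
  have hle : v (s / a) ≤ 1 := by
    by_contra! h1
    generalize s / a = r at *
    have h2 : v (r * (r + 1)) ≤ 1 := by
      rw [show r * (r + 1) = 3 / a ^ 2 - 1 by linear_combination hr]
      exact v.map_sub_le hlt.le (by simp)
    rw [map_mul, v.map_add_eq_of_lt_left (by simpa using h1)] at h2
    exact absurd h2 (not_le.2 (one_lt_mul'' h1 h1))
  set r : p.ring := ⟨s / a, (p.ring.valuation_le_one_iff _).1 hle⟩
  refine FiniteField.even_finrank_of_sq_add_self_add_one_eq_zero hk
    (c := IsLocalRing.residue p.ring r) ?_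
  rw [← map_pow, ← map_add, ← map_one (IsLocalRing.residue p.ring), ← map_add,
    IsLocalRing.residue_eq_zero_iff, ValuationSubring.valuation_lt_one_iff]
  change v ((s / a) ^ 2 + s / a + 1) < 1
  rwa [hr]

end Degree

/-! ### Places above an integral value of a are unramified -/

section Ramification

variable {k K L : Type*} [Field k] [Field K] [Field L] [Algebra k K] [Algebra k L] [Algebra K L]

theorem LiesOver.mem_iff {P : Place k L} {p : Place k K} (h : P.LiesOver p) {x : K} :
    algebraMap K L x ∈ P.ring ↔ x ∈ p.ring := by
  rw [← show P.ring.comap (algebraMap K L) = p.ring from h]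
  rfl

theorem LiesOver.mem_nonunits_iff {P : Place k L} {p : Place k K} (h : P.LiesOver p) {x : K} :
    algebraMap K L x ∈ P.ring.nonunits ↔ x ∈ p.ring.nonunits := by
  rw [ValuationSubring.mem_nonunits_iff_or, ValuationSubring.mem_nonunits_iff_or, ← map_inv₀,
    h.mem_iff, map_eq_zero]

theorem LiesOver.ramificationIdx_le_one {P : Place k L} {p : Place k K} (h : P.LiesOver p)
    [FiniteDimensional K L] {σ : L ≃ₐ[K] L} (hσ : IsCubicGenerator σ) {y : L} {a : K}
    (hy : IsImpureRoot σ y a) (h3 : P.ring.valuation 3 = 1) (ha : a ∈ p.ring) :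
    h.ramificationIdx ≤ 1 := by
  let : Algebra p.ring P.ring := h.ringHom.toAlgebra
  refine Ideal.ramificationIdx'_le_one fun x hx ↦ ?_
  obtain ⟨u, b, c, hu, hb, hc, hsum⟩ := hy.exists_combination hσ P.ring.valuation h3
    ((P.ring.valuation_le_one_iff _).2 (h.mem_iff.2 ha)) (x := x)
    ((ValuationSubring.valuation_lt_one_iff _ _).1 hx)
  have hcp (i : Fin 3) : c i ∈ p.ring.nonunits := h.mem_nonunits_iff.1 (hc i)
  set u' : P.ring := ⟨u, (P.ring.valuation_le_one_iff _).1 hu.le⟩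
  set b' : P.ring := ⟨b, (P.ring.valuation_le_one_iff _).1 hb⟩
  set c' : Fin 3 → p.ring := fun i ↦ ⟨c i, p.ring.nonunits_le (hcp i)⟩
  have hunit : IsUnit u' := (P.ring.valuation_eq_one_iff u').2 hu
  have heq : u' * x = ∑ i, algebraMap p.ring P.ring (c' i) * b' ^ (i : ℕ) := by
    refine Subtype.val_injective ?_
    simp only [Fin.sum_univ_three] at hsum ⊢
    exact hsum
  rw [← Ideal.unit_mul_mem_iff_mem _ hunit, heq]
  exact Ideal.sum_mem _ fun i _ ↦ Ideal.mul_mem_right _ _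
    (Ideal.mem_map_of_mem _ (ValuationSubring.coe_mem_nonunits_iff.1 (hcp i)))

end Ramification

end Place

theorem mainTheorem8
    {k K L : Type*} [Field k] [Finite k] [Field K] [Field L]
    -- `K` is a function field over the finite field `k`, its exact field of constants
    [Algebra k K] [Algebra (RatFunc k) K] [IsScalarTower k (RatFunc k) K] [FunctionField k K]
    (hconst : algebraicClosure k K = ⊥)
    -- `q ≡ -1 mod 3`, where `q` is the cardinality of `k`
    (hq : (Nat.card k : ℤ) ≡ -1 [ZMOD 3])
    -- `L/K` is a Galois cubic extension
    [Algebra K L] [Algebra k L] [IsScalarTower k K L]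
    [IsGalois K L] (hcubic : Module.finrank K L = 3) :
    (∃ (y : L) (a : K), IsImpureGenerator y a) ∧
    (∀ p : Place k K, p.IsRamified L → Even p.degree) ∧
    (∀ (y : L) (a : K), IsImpureGenerator y a →
      ∀ p : Place k K, (p.IsRamified L → p.ValNeg a) ∧ (p.ValNeg a → Even p.degree)) := by
  have : FiniteDimensional K L := Module.finite_of_finrank_pos (by omega)
  obtain ⟨σ, hσ⟩ := exists_isCubicGenerator hcubic
  have h3k : (3 : k) ≠ 0 := FiniteField.three_ne_zero_of_card hq
  have h3 : (3 : L) ≠ 0 := by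
    simpa [map_ofNat] using (map_ne_zero (algebraMap k L)).2 h3k
  have hgen := hσ.exists_isImpureGenerator hcubic h3
    (sq_add_self_add_one_ne_zero_of_algebraicClosure_eq_bot hconst hq)
  have key (y : L) (a : K) (hy : IsImpureGenerator y a) (p : Place k K) :
      (p.IsRamified L → p.ValNeg a) ∧ (p.ValNeg a → Even p.degree) := by
    have hroot := hy.isImpureRoot hσ
    constructor
    · rintro ⟨P, h, hram⟩
      by_contra hneg
      refine hram.not_ge (h.ramificationIdx_le_one hσ hroot ?_ ?_)
      · simpa [map_ofNat] using P.valuation_algebraMap h3k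
      · exact (p.ring.valuation_le_one_iff a).1 (not_lt.1 hneg)
    · obtain ⟨s, hs⟩ := hroot.exists_resolvent_root hσ h3
      exact Place.ValNeg.even_degree hq hs
  refine ⟨hgen, fun p hp ↦ ?_, key⟩
  obtain ⟨y, a, hy⟩ := hgen
  exact (key y a hy p).2 ((key y a hy p).1 hp)
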